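/- Let $\mathcal T$ be a finite tree with nonnegative edge lengths, regarded as the set of all nodes together with all points on the edges, and let $d_{\mathcal T}(x,y)$ be the length of the unique path between $x$ and $y$ (points at distance zero are identified). Let $b\ge 0$, $\lambda\ge 0$, and let $w_1,w_2:\mathcal T\to[0,\infty)$ be $b$-Lipschitz with respect to $d_{\mathcal T}$. Let $\mu,\nu$ be finite nonnegative Borel measures on $\mathcal T$, and let $\Pi_{\le}(\mu,\nu)$ be the set of finite nonnegative Borel measures $\gamma$ on $\mathcal T\times\mathcal T$ whose marginals satisfy $\gamma_1\le\mu$ and $\gamma_2\le\nu$. Define $$\mathrm{ET}_\lambda(\mu,\nu)=\inf_{\gamma\in\Pi_{\le}(\mu,\nu)}\Big[\int_{\mathcal T} w_1\Big|\frac{d\gamma_1}{d\mu}-1\Big|\,d\mu+\int_{\mathcal T} w_2\Big|\frac{d\gamma_2}{d\nu}-1\Big|\,d\nu+b\int_{\mathcal T\times\mathcal T}\big[d_{\mathcal T}(x,y)-\lambda\big]\,\gamma(dx,dy)\Big].$$ Then $$\mathrm{ET}_\lambda(\mu,\nu)=\sup\Big\{\int_{\mathcal T} f\,d\mu-\int_{\mathcal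 T} f\,d\nu:\ f\in\mathbb L\Big\}-\frac{b\lambda}{2}\big[\mu(\mathcal T)+\nu(\mathcal T)\big],$$ where $\mathbb L$ is the set of all continuous $f:\mathcal T\to\mathbb R$ such that $-w_2(x)-\frac{b\lambda}{2}\le f(x)\le w_1(x)+\frac{b\lambda}{2}$ and $|f(x)-f(y)|\le b\,d_{\mathcal T}(x,y)$ for all $x,y\in\mathcal T$. -/

import Mathlib

open MeasureTheory

/-- A tree `(V, E)` with nonnegative edge lengths (only the values of `length` on edges matter). -/
structure WeightedTree (V : Type*) where
  graph : SimpleGraph V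
  isTree : graph.IsTree
  length : Sym2 V → ℝ
  length_nonneg : ∀ e ∈ graph.edgeSet, 0 ≤ length e

namespace WeightedTree

variable {V : Type*} (T : WeightedTree V)

/-- The total length of a walk in the tree. -/
def walkLength {u v : V} (p : T.graph.Walk u v) : ℝ := (p.edges.map T.length).sum

/-- The unique path between two nodes. -/
noncomputable def path (u v : V) : T.graph.Walk u v :=
  (T.isTree.existsUnique_path u v).choose

theorem path_isPath (u v : V) : (T.path u v).IsPath :=
  (T.isTree.existsUnique_path u v).choose_spec.1

theorem path_unique {u v : V} {p : T.graph.Walk u v} (hp : p.IsPath) : p = T.path u v :=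
  (T.isTree.existsUnique_path u v).choose_spec.2 p hp

/-- The tree distance between two nodes: the length of the unique path between them. -/
noncomputable def nodeDist (u v : V) : ℝ := T.walkLength (T.path u v)

theorem nodeDist_le_walkLength {u v : V} (p : T.graph.Walk u v) :
    T.nodeDist u v ≤ T.walkLength p := by
  classical
  have h : p.bypass = T.path u v := T.path_unique p.bypass_isPath
  rw [nodeDist, ← h]
  refine (p.edges_bypass_sublist_edges.map T.length).sum_le_sum ?_
  intro a ha
  obtain ⟨e, he, rfl⟩ := List.mem_map.1 ha
  exact T.length_nonneg e (p.edges_subset_edgeSet he)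

theorem nodeDist_nonneg (u v : V) : 0 ≤ T.nodeDist u v := by
  refine List.sum_nonneg ?_
  intro a ha
  obtain ⟨e, he, rfl⟩ := List.mem_map.1 ha
  exact T.length_nonneg e ((T.path u v).edges_subset_edgeSet he)

theorem nodeDist_self (u : V) : T.nodeDist u u = 0 :=
  le_antisymm (by simpa [walkLength] using T.nodeDist_le_walkLength (SimpleGraph.Walk.nil (u := u)))
    (T.nodeDist_nonneg u u)

theorem nodeDist_comm (u v : V) : T.nodeDist u v = T.nodeDist v u := by
  have h : ∀ a b : V, T.nodeDist a b ≤ T.nodeDist b a := fun a b => by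
    simpa [walkLength, nodeDist] using T.nodeDist_le_walkLength (T.path b a).reverse
  exact le_antisymm (h u v) (h v u)

theorem nodeDist_triangle (u v w : V) : T.nodeDist u w ≤ T.nodeDist u v + T.nodeDist v w := by
  simpa [walkLength, nodeDist] using T.nodeDist_le_walkLength ((T.path u v).append (T.path v w))

theorem nodeDist_of_adj {u v : V} (h : T.graph.Adj u v) : T.nodeDist u v = T.length s(u, v) := by
  have hp : h.toWalk.IsPath := by simp [SimpleGraph.Walk.isPath_def, h.ne]
  rw [nodeDist, ← T.path_unique hp]
  simp [walkLength]

/-- A description of a point of the tree: either a node (`fst = snd`, both distances zero), or a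
point of the edge joining `fst` and `snd`, at distance `toFst` from `fst` and `toSnd` from `snd`
along the edge.  (When `fst` and `snd` are adjacent, `nodeDist fst snd` is the length of the edge
joining them, see `nodeDist_of_adj`.) -/
structure PrePoint where
  fst : V
  snd : V
  eq_or_adj : fst = snd ∨ T.graph.Adj fst snd
  toFst : ℝ
  toSnd : ℝ
  toFst_nonneg : 0 ≤ toFst
  toSnd_nonneg : 0 ≤ toSnd
  add_eq : toFst + toSnd = T.nodeDist fst snd

variable {T}

namespace PrePoint

/-- The length of the shortest route from `p` to `q` which leaves the edge of `p` through one of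
its two end nodes and enters the edge of `q` through one of its two end nodes. -/
noncomputable def routeDist (p q : T.PrePoint) : ℝ :=
  min
    (min (p.toFst + T.nodeDist p.fst q.fst + q.toFst)
      (p.toFst + T.nodeDist p.fst q.snd + q.toSnd))
    (min (p.toSnd + T.nodeDist p.snd q.fst + q.toFst)
      (p.toSnd + T.nodeDist p.snd q.snd + q.toSnd))

open Classical in
/-- The tree distance: the length of the path between two points. For two points of the same edge
(the two descriptions may orient this edge differently) the path runs inside the edge. -/
noncomputable def treeDist (p q : T.PrePoint) : ℝ :=
  if p.fst = q.fst ∧ p.snd = q.snd then |p.toFst - q.toFst|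
  else if p.fst = q.snd ∧ p.snd = q.fst then |p.toFst - q.toSnd|
  else p.routeDist q

theorem treeDist_self (p : T.PrePoint) : p.treeDist p = 0 := by simp [treeDist]

theorem routeDist_comm (p q : T.PrePoint) : p.routeDist q = q.routeDist p := by
  unfold routeDist
  rw [T.nodeDist_comm q.fst p.fst, T.nodeDist_comm q.fst p.snd, T.nodeDist_comm q.snd p.fst,
    T.nodeDist_comm q.snd p.snd, min_min_min_comm]
  have e : ∀ x y z : ℝ, x + y + z = z + y + x := fun x y z => by ring
  rw [e p.toFst _ q.toFst, e p.toSnd _ q.toFst, e p.toFst _ q.toSnd, e p.toSnd _ q.toSnd]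

theorem treeDist_eq_of_same {p q : T.PrePoint} (h : p.fst = q.fst ∧ p.snd = q.snd) :
    p.treeDist q = |p.toFst - q.toFst| := if_pos h

theorem treeDist_eq_of_swap {p q : T.PrePoint} (h : p.fst = q.snd ∧ p.snd = q.fst) :
    p.treeDist q = |p.toFst - q.toSnd| := by
  by_cases c : p.fst = q.fst ∧ p.snd = q.snd
  · have h2 := q.add_eq
    rw [← c.1, h.1, T.nodeDist_self] at h2
    have := q.toFst_nonneg; have := q.toSnd_nonneg
    rw [treeDist_eq_of_same c]
    congr 1; linarith
  · rw [treeDist, if_neg c, if_pos h]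

theorem treeDist_eq_of_ne {p q : T.PrePoint} (h : ¬(p.fst = q.fst ∧ p.snd = q.snd))
    (h' : ¬(p.fst = q.snd ∧ p.snd = q.fst)) : p.treeDist q = p.routeDist q := by
  rw [treeDist, if_neg h, if_neg h']

theorem treeDist_comm (p q : T.PrePoint) : p.treeDist q = q.treeDist p := by
  have h1 := p.add_eq
  have h2 := q.add_eq
  by_cases c1 : p.fst = q.fst ∧ p.snd = q.snd
  · rw [treeDist_eq_of_same c1, treeDist_eq_of_same ⟨c1.1.symm, c1.2.symm⟩, abs_sub_comm]
  by_cases c2 : p.fst = q.snd ∧ p.snd = q.fst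
  · rw [treeDist_eq_of_swap c2, treeDist_eq_of_swap ⟨c2.2.symm, c2.1.symm⟩]
    rw [c2.1, c2.2, T.nodeDist_comm] at h1
    congr 1; linarith
  · rw [treeDist_eq_of_ne c1 c2, routeDist_comm, ← treeDist_eq_of_ne]
    · exact fun h => c1 ⟨h.1.symm, h.2.symm⟩
    · exact fun h => c2 ⟨h.2.symm, h.1.symm⟩

/-- The same point, with the two end nodes of its edge listed in the other order. -/
noncomputable def flip (p : T.PrePoint) : T.PrePoint where
  fst := p.snd
  snd := p.fst
  eq_or_adj := p.eq_or_adj.imp Eq.symm SimpleGraph.Adj.symm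
  toFst := p.toSnd
  toSnd := p.toFst
  toFst_nonneg := p.toSnd_nonneg
  toSnd_nonneg := p.toFst_nonneg
  add_eq := by rw [add_comm, p.add_eq, T.nodeDist_comm]

theorem routeDist_flip (p q : T.PrePoint) : p.flip.routeDist q = p.routeDist q := by
  simp only [routeDist, flip]
  rw [min_comm]

theorem treeDist_flip (p q : T.PrePoint) : p.flip.treeDist q = p.treeDist q := by
  have h1 := p.add_eq
  have h2 := q.add_eq
  by_cases c1 : p.fst = q.fst ∧ p.snd = q.snd
  · rw [treeDist_eq_of_same c1, treeDist_eq_of_swap (p := p.flip) ⟨c1.2, c1.1⟩, abs_sub_comm]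
    rw [c1.1, c1.2] at h1
    simp only [flip]
    congr 1; linarith
  by_cases c2 : p.fst = q.snd ∧ p.snd = q.fst
  · rw [treeDist_eq_of_swap c2, treeDist_eq_of_same (p := p.flip) ⟨c2.2, c2.1⟩, abs_sub_comm]
    rw [c2.1, c2.2, T.nodeDist_comm] at h1
    simp only [flip]
    congr 1; linarith
  · rw [treeDist_eq_of_ne c1 c2, ← routeDist_flip, ← treeDist_eq_of_ne]
    · exact fun h => c2 ⟨h.2, h.1⟩
    · exact fun h => c1 ⟨h.2, h.1⟩

theorem treeDist_flip_right (p q : T.PrePoint) : p.treeDist q.flip = p.treeDist q := by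
  rw [treeDist_comm, treeDist_flip, treeDist_comm]

/-- Two points lie on the same edge, or their distance is `routeDist`. -/
theorem treeDist_cases (p q : T.PrePoint) :
    (p.fst = q.fst ∧ p.snd = q.snd) ∨ (p.fst = q.flip.fst ∧ p.snd = q.flip.snd) ∨
      p.treeDist q = p.routeDist q := by
  by_cases c1 : p.fst = q.fst ∧ p.snd = q.snd
  · exact Or.inl c1
  · by_cases c2 : p.fst = q.snd ∧ p.snd = q.fst
    · exact Or.inr (Or.inl c2)
    · right; right
      rw [treeDist, if_neg c1, if_neg c2]

theorem treeDist_le_routeDist (p q : T.PrePoint) : p.treeDist q ≤ p.routeDist q := by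
  have key : ∀ q : T.PrePoint, (p.fst = q.fst ∧ p.snd = q.snd) → p.treeDist q ≤ p.routeDist q := by
    intro q h
    have h1 := p.add_eq
    have h2 := q.add_eq
    rw [treeDist_eq_of_same h]
    unfold routeDist
    rw [h.1, h.2, T.nodeDist_comm q.snd q.fst, T.nodeDist_self, T.nodeDist_self]
    rw [h.1, h.2] at h1
    have := p.toFst_nonneg; have := p.toSnd_nonneg
    have := q.toFst_nonneg; have := q.toSnd_nonneg
    refine le_min (le_min ?_ ?_) (le_min ?_ ?_) <;> refine abs_le.2 ⟨?_, ?_⟩ <;> linarith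
  rcases p.treeDist_cases q with h | h | h
  · exact key q h
  · have := key q.flip h
    rwa [treeDist_flip_right, routeDist_comm, routeDist_flip, routeDist_comm] at this
  · exact h.le

theorem routeDist_le_of_same {p q : T.PrePoint} (h : p.fst = q.fst ∧ p.snd = q.snd)
    (r : T.PrePoint) : p.routeDist r ≤ |p.toFst - q.toFst| + q.routeDist r := by
  have h1 := p.add_eq
  have h2 := q.add_eq
  rw [h.1, h.2] at h1
  have a1 := le_abs_self (p.toFst - q.toFst)
  have a2 := neg_abs_le (p.toFst - q.toFst)
  unfold routeDist
  rw [h.1, h.2, ← min_add_add_left, ← min_add_add_left, ← min_add_add_left]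
  refine min_le_min (min_le_min ?_ ?_) (min_le_min ?_ ?_) <;> linarith

theorem abs_le_routeDist_add {p r : T.PrePoint} (h : p.fst = r.fst ∧ p.snd = r.snd)
    (q : T.PrePoint) : |p.toFst - r.toFst| ≤ p.routeDist q + q.routeDist r := by
  have h1 := p.add_eq
  have h2 := r.add_eq
  rw [h.1, h.2] at h1
  have := p.toFst_nonneg; have := p.toSnd_nonneg
  have := r.toFst_nonneg; have := r.toSnd_nonneg
  have := q.toFst_nonneg; have := q.toSnd_nonneg
  have h3 := q.add_eq
  have n1 := T.nodeDist_nonneg r.fst q.fst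
  have n2 := T.nodeDist_nonneg r.fst q.snd
  have n3 := T.nodeDist_nonneg r.snd q.fst
  have n4 := T.nodeDist_nonneg r.snd q.snd
  have t1 := T.nodeDist_triangle r.fst q.fst r.snd
  have t2 := T.nodeDist_triangle r.fst q.snd r.snd
  have t3 := T.nodeDist_triangle r.fst q.fst q.snd
  have t4 := T.nodeDist_triangle q.fst q.snd r.snd
  have t5 := T.nodeDist_triangle r.fst q.snd q.fst
  have t6 := T.nodeDist_triangle q.snd q.fst r.snd
  have c := T.nodeDist_comm q.snd q.fst
  rw [r.routeDist_comm q |>.symm]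
  unfold routeDist
  rw [h.1, h.2]
  rw [T.nodeDist_comm q.fst r.snd] at t1 t6
  rw [T.nodeDist_comm q.snd r.snd] at t2 t4
  rcases min_choice (min (p.toFst + T.nodeDist r.fst q.fst + q.toFst)
      (p.toFst + T.nodeDist r.fst q.snd + q.toSnd))
    (min (p.toSnd + T.nodeDist r.snd q.fst + q.toFst)
      (p.toSnd + T.nodeDist r.snd q.snd + q.toSnd)) with e | e <;> rw [e] <;>
  rcases min_choice (min (r.toFst + T.nodeDist r.fst q.fst + q.toFst)
      (r.toFst + T.nodeDist r.fst q.snd + q.toSnd))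
    (min (r.toSnd + T.nodeDist r.snd q.fst + q.toFst)
      (r.toSnd + T.nodeDist r.snd q.snd + q.toSnd)) with e' | e' <;> rw [e'] <;>
  simp only [min_def] <;> split_ifs <;> refine abs_le.2 ⟨?_, ?_⟩ <;> linarith

theorem routeDist_triangle (p q r : T.PrePoint) :
    p.routeDist r ≤ p.routeDist q + q.routeDist r := by
  have := q.toFst_nonneg; have := q.toSnd_nonneg
  have hq := q.add_eq
  have key : ∀ (x y : V) (a b : ℝ), p.routeDist r ≤ a + T.nodeDist x y + b →
      p.routeDist r ≤ (a + T.nodeDist x q.fst + q.toFst) + (q.toFst + T.nodeDist q.fst y + b) ∧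
      p.routeDist r ≤ (a + T.nodeDist x q.fst + q.toFst) + (q.toSnd + T.nodeDist q.snd y + b) ∧
      p.routeDist r ≤ (a + T.nodeDist x q.snd + q.toSnd) + (q.toFst + T.nodeDist q.fst y + b) ∧
      p.routeDist r ≤ (a + T.nodeDist x q.snd + q.toSnd) + (q.toSnd + T.nodeDist q.snd y + b) := by
    intro x y a b h
    have t1 := T.nodeDist_triangle x q.fst y
    have t2 := T.nodeDist_triangle x q.snd y
    have t3 := T.nodeDist_triangle q.fst q.snd y
    have t4 := T.nodeDist_triangle q.snd q.fst y
    have c := T.nodeDist_comm q.snd q.fst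
    refine ⟨?_, ?_, ?_, ?_⟩ <;> linarith
  obtain ⟨a1, a2, a3, a4⟩ := key p.fst r.fst p.toFst r.toFst
    ((min_le_left _ _).trans (min_le_left _ _))
  obtain ⟨b1, b2, b3, b4⟩ := key p.fst r.snd p.toFst r.toSnd
    ((min_le_left _ _).trans (min_le_right _ _))
  obtain ⟨c1, c2, c3, c4⟩ := key p.snd r.fst p.toSnd r.toFst
    ((min_le_right _ _).trans (min_le_left _ _))
  obtain ⟨d1, d2, d3, d4⟩ := key p.snd r.snd p.toSnd r.toSnd
    ((min_le_right _ _).trans (min_le_right _ _))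
  generalize p.routeDist r = D at *
  unfold routeDist
  simp only [min_def]
  split_ifs <;> linarith

theorem treeDist_triangle (p q r : T.PrePoint) :
    p.treeDist r ≤ p.treeDist q + q.treeDist r := by
  -- after flipping, points on a common edge are described with a common orientation
  have main : ∀ p q r : T.PrePoint, (p.fst = q.fst ∧ p.snd = q.snd) →
      p.treeDist r ≤ p.treeDist q + q.treeDist r := by
    intro p q r h
    rw [treeDist_eq_of_same h]
    have key : ∀ r : T.PrePoint, (q.fst = r.fst ∧ q.snd = r.snd) →
        p.treeDist r ≤ |p.toFst - q.toFst| + q.treeDist r := by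
      intro r h'
      rw [treeDist_eq_of_same h', treeDist_eq_of_same ⟨h.1.trans h'.1, h.2.trans h'.2⟩]
      exact abs_sub_le _ _ _
    rcases q.treeDist_cases r with h' | h' | h'
    · exact key r h'
    · simpa only [treeDist_flip_right] using key r.flip h'
    · rw [h']
      exact (treeDist_le_routeDist p r).trans (routeDist_le_of_same h r)
  have main2 : ∀ q : T.PrePoint, (p.fst = q.fst ∧ p.snd = q.snd) ∨
      (p.fst = q.flip.fst ∧ p.snd = q.flip.snd) → ∀ r : T.PrePoint,
      p.treeDist r ≤ p.treeDist q + q.treeDist r := by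
    rintro q (h | h) r
    · exact main p q r h
    · simpa only [treeDist_flip_right, treeDist_flip] using main p q.flip r h
  rcases p.treeDist_cases q with h | h | h
  · exact main2 q (Or.inl h) r
  · exact main2 q (Or.inr h) r
  rcases r.treeDist_cases q with h' | h' | h'
  · have := main r q p h'
    rw [r.treeDist_comm p, r.treeDist_comm q, q.treeDist_comm p] at this
    linarith
  · have := main r q.flip p h'
    rw [treeDist_flip_right, treeDist_flip, r.treeDist_comm p, r.treeDist_comm q,
      q.treeDist_comm p] at this
    linarith
  rw [h, q.treeDist_comm r, h', r.routeDist_comm q]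
  have key : ∀ r : T.PrePoint, (p.fst = r.fst ∧ p.snd = r.snd) →
      p.treeDist r ≤ p.routeDist q + q.routeDist r := by
    intro r e
    rw [treeDist_eq_of_same e]
    exact abs_le_routeDist_add e q
  rcases p.treeDist_cases r with e | e | e
  · exact key r e
  · have := key r.flip e
    rwa [treeDist_flip_right, q.routeDist_comm, routeDist_flip, r.routeDist_comm] at this
  · rw [e]
    exact routeDist_triangle p q r

noncomputable instance : PseudoMetricSpace T.PrePoint where
  dist := treeDist
  dist_self := treeDist_self
  dist_comm := treeDist_comm
  dist_triangle := treeDist_triangle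

end PrePoint

variable (T)

/-- The geometric tree: all nodes together with all points on the edges, with the tree metric.
Descriptions at distance zero are descriptions of the same point (in particular, edges of length
zero are collapsed). -/
def Space : Type _ := SeparationQuotient T.PrePoint

noncomputable instance : MetricSpace T.Space :=
  inferInstanceAs (MetricSpace (SeparationQuotient T.PrePoint))

noncomputable instance : MeasurableSpace T.Space := borel T.Space

instance : BorelSpace T.Space := ⟨rfl⟩

end WeightedTree

namespace EntropyPartialTransport

variable {X : Type*} [MeasurableSpace X]

/-- `Π_≤(μ, ν)`: finite measures on the product whose marginals are dominated by `μ` and `ν`. -/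
def partialPlans (μ ν : Measure X) : Set (Measure (X × X)) :=
  {γ | IsFiniteMeasure γ ∧ γ.fst ≤ μ ∧ γ.snd ≤ ν}

/-- The weighted relative entropy `∫ w F(dσ/dμ) dμ` of `σ` with respect to `μ`. -/
noncomputable def weightedEntropy (F : ℝ → ℝ) (w : X → ℝ) (σ μ : Measure X) : ℝ :=
  ∫ x, w x * F (σ.rnDeriv μ x).toReal ∂μ

/-- The objective of the entropy partial transport problem, with `F₁(s) = F₂(s) = |s - 1|`. -/
noncomputable def objective (c : X → X → ℝ) (w₁ w₂ : X → ℝ) (b lam : ℝ) (μ ν : Measure X)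
    (γ : Measure (X × X)) : ℝ :=
  weightedEntropy (fun s => |s - 1|) w₁ γ.fst μ + weightedEntropy (fun s => |s - 1|) w₂ γ.snd ν
    + b * ∫ z, (c z.1 z.2 - lam) ∂γ

/-- `ET_{c,λ}(μ, ν)`: the infimum of the objective over `Π_≤(μ, ν)`, in the extended reals. -/
noncomputable def ET (c : X → X → ℝ) (w₁ w₂ : X → ℝ) (b lam : ℝ) (μ ν : Measure X) : EReal :=
  ⨅ γ ∈ partialPlans μ ν, (objective c w₁ w₂ b lam μ ν γ : EReal)

/-- The set `𝕃` of admissible dual potentials. -/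
def potentials {Y : Type*} [MetricSpace Y] (w₁ w₂ : Y → ℝ) (b lam : ℝ) : Set C(Y, ℝ) :=
  {f | (∀ x, -w₂ x - b * lam / 2 ≤ f x ∧ f x ≤ w₁ x + b * lam / 2) ∧
    ∀ x y, |f x - f y| ≤ b * dist x y}

end EntropyPartialTransport

/-!
The formula is linear programming duality on a compact metric space, followed by a reduction of the
dual variables to one Lipschitz potential.

For a plan `γ` the densities of its marginals are at most `1`, so each entropy term is the weighted
mass that is removed, and the objective equals `∫ w₁ dμ + ∫ w₂ dν - ∫ k dγ` with the continuous gain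
`k(x, y) = w₁(x) + w₂(y) + bλ - b d(x, y)` (`objective_eq`). It remains to maximize `∫ k dγ` over
`Π_≤(μ, ν)`. The dual problem is to minimize `∫ u dμ + ∫ v dν` over continuous `u, v ≥ 0` with
`k(x, y) ≤ u(x) + v(y)`; weak duality is immediate. As a function of `k` the dual value
`dualCost μ ν k` is sublinear, so by Hahn–Banach some linear functional on `C(X × X, ℝ)` lies below
it and agrees with it at the given `k`. This functional is positive, hence by
Riesz–Markov–Kakutani it is integration against a measure, whose marginals are dominated by `μ`
and `ν`: an optimal plan (`exists_partialPlan_integral_eq_dualCost`).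

A potential `f` yields the dual pair `(w₁ + bλ/2 - f, w₂ + bλ/2 + f)`. Conversely, since `w₁` and
`w₂` are `b`-Lipschitz, an infimal convolution with `b d` replaces any dual pair by a pair of this
form of no larger cost (`exists_mem_potentials_le`). The tree enters only through its compactness:
it is a finite union of isometric images of compact intervals.
-/

open MeasureTheory

/-! ### Measures on compact metric spaces -/

namespace MeasureTheory

theorem integrable_of_continuous_of_compactSpace {X : Type*} [TopologicalSpace X] [T2Space X]
    [CompactSpace X] [MeasurableSpace X] [BorelSpace X] {f : X → ℝ} (hf : Continuous f)
    (μ : Measure X) [IsFiniteMeasure μ] : Integrable f μ :=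
  integrableOn_univ.1 (hf.continuousOn.integrableOn_compact isCompact_univ)

/-- Finite Borel measures on a metric space are ordered as soon as their integrals of nonnegative
continuous functions are; thickened indicators give closed sets, inner regularity the rest. -/
theorem Measure.le_of_forall_integral_continuousMap_le {X : Type*} [PseudoMetricSpace X]
    [MeasurableSpace X] [BorelSpace X] {μ ν : Measure X} [IsFiniteMeasure μ] [IsFiniteMeasure ν]
    (h : ∀ f : C(X, ℝ), (∀ x, 0 ≤ f x) → ∫ x, f x ∂μ ≤ ∫ x, f x ∂ν) : μ ≤ ν := by
  have closed : ∀ F : Set X, IsClosed F → μ F ≤ ν F := by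
    intro F hF
    have lim := tendsto_one_div_add_atTop_nhds_zero_nat (𝕜 := ℝ)
    have pos : ∀ n : ℕ, (0 : ℝ) < 1 / (n + 1) := fun n => Nat.one_div_pos_of_nat
    have key := le_of_tendsto_of_tendsto'
      (tendsto_integral_thickenedIndicator_of_isClosed μ hF pos lim)
      (tendsto_integral_thickenedIndicator_of_isClosed ν hF pos lim) fun n =>
        h ⟨fun x => (thickenedIndicator (pos n) F x : ℝ),
          NNReal.continuous_coe.comp (thickenedIndicator (pos n) F).continuous⟩
          fun x => NNReal.coe_nonneg _
    exact (ENNReal.toReal_le_toReal (measure_ne_top _ _) (measure_ne_top _ _)).1 key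
  refine Measure.le_iff.2 fun A hA => ?_
  rw [hA.measure_eq_iSup_isClosed_of_ne_top (measure_ne_top μ A)]
  exact iSup_le fun K => iSup_le fun hKA => iSup_le fun hK =>
    (closed K hK).trans (measure_mono hKA)

/-- The Riesz–Markov–Kakutani theorem for positive functionals on `C(X, ℝ)`, `X` compact. -/
theorem exists_measure_integral_eq_of_nonneg {X : Type*} [TopologicalSpace X] [T2Space X]
    [CompactSpace X] [MeasurableSpace X] [BorelSpace X] (L : C(X, ℝ) →ₗ[ℝ] ℝ)
    (hL : ∀ f : C(X, ℝ), (∀ x, 0 ≤ f x) → 0 ≤ L f) :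
    ∃ γ : Measure X, IsFiniteMeasure γ ∧ ∀ f : C(X, ℝ), ∫ x, f x ∂γ = L f := by
  let Λ : CompactlySupportedContinuousMap X ℝ →ₚ[ℝ] ℝ := .mk₀
    { toFun := fun f => L (CompactlySupportedContinuousMap.continuousMapEquiv.symm f)
      map_add' := fun f g => L.map_add _ _
      map_smul' := fun c f => L.map_smul _ _ } fun f hf => hL _ hf
  refine ⟨RealRMK.rieszMeasure Λ, ?_, fun f => ?_⟩
  · have : IsFiniteMeasureOnCompacts (RealRMK.rieszMeasure Λ) := by infer_instance
    exact ⟨isCompact_univ.measure_lt_top⟩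
  · exact RealRMK.integral_rieszMeasure Λ (CompactlySupportedContinuousMap.continuousMapEquiv f)

end MeasureTheory

/-! ### Duality for partial transport with a continuous gain -/

namespace EntropyPartialTransport

/-- For `σ ≤ μ` the density of `σ` is at most `1`, so the entropy with `F(s) = |s - 1|` is the
weighted mass removed from `μ`. -/
theorem weightedEntropy_abs_sub_one {X : Type*} [MeasurableSpace X] {w : X → ℝ} {σ μ : Measure X}
    [IsFiniteMeasure μ] (hσ : σ ≤ μ) (hw : Integrable w μ) :
    weightedEntropy (fun s => |s - 1|) w σ μ = ∫ x, w x ∂μ - ∫ x, w x ∂σ := by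
  have : IsFiniteMeasure σ := isFiniteMeasure_of_le μ hσ
  have hac : σ ≪ μ := Measure.absolutelyContinuous_of_le hσ
  have hint : Integrable (fun x => (σ.rnDeriv μ x).toReal * w x) μ :=
    (integrable_rnDeriv_smul_iff hac).2 (hw.mono_measure hσ)
  rw [← integral_toReal_rnDeriv_mul hac, ← integral_sub hw hint]
  refine integral_congr_ae ?_
  filter_upwards [Measure.rnDeriv_le_one_of_le hσ] with x hx
  have h1 : (σ.rnDeriv μ x).toReal ≤ 1 :=
    ENNReal.toReal_le_of_le_ofReal zero_le_one (by simpa using hx)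
  rw [abs_of_nonpos (by linarith)]
  ring

section Duality

variable {X : Type*} [MetricSpace X]

/-- The pairs of nonnegative continuous functions `(u, v)` with `h(x, y) ≤ u(x) + v(y)`. -/
def dominatingPairs (h : C(X × X, ℝ)) : Set (C(X, ℝ) × C(X, ℝ)) :=
  {p | (∀ x, 0 ≤ p.1 x) ∧ (∀ y, 0 ≤ p.2 y) ∧ ∀ x y, h (x, y) ≤ p.1 x + p.2 y}

theorem dominatingPairs_nonempty [CompactSpace X] (h : C(X × X, ℝ)) :
    (dominatingPairs h).Nonempty := by
  refine ⟨(.const X ‖h‖, 0), fun x => norm_nonneg h, fun y => le_rfl, fun x y => ?_⟩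
  simpa using (le_abs_self _).trans (h.norm_coe_le_norm (x, y))

variable [MeasurableSpace X]

/-- The least cost `∫ u dμ + ∫ v dν` of a pair dominating `h`: the dual problem to maximizing
`∫ h dγ` over `Π_≤(μ, ν)`. -/
noncomputable def dualCost (μ ν : Measure X) (h : C(X × X, ℝ)) : ℝ :=
  sInf ((fun p : C(X, ℝ) × C(X, ℝ) => ∫ x, p.1 x ∂μ + ∫ y, p.2 y ∂ν) '' dominatingPairs h)

variable {μ ν : Measure X}

theorem dualCost_le {h : C(X × X, ℝ)} {p : C(X, ℝ) × C(X, ℝ)} (hp : p ∈ dominatingPairs h) :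
    dualCost μ ν h ≤ ∫ x, p.1 x ∂μ + ∫ y, p.2 y ∂ν := by
  refine csInf_le ⟨0, ?_⟩ ⟨p, hp, rfl⟩
  rintro _ ⟨q, hq, rfl⟩
  exact add_nonneg (integral_nonneg hq.1) (integral_nonneg hq.2.1)

variable [CompactSpace X]

theorem le_dualCost {h : C(X × X, ℝ)} {r : ℝ}
    (hr : ∀ p ∈ dominatingPairs h, r ≤ ∫ x, p.1 x ∂μ + ∫ y, p.2 y ∂ν) : r ≤ dualCost μ ν h := by
  refine le_csInf ((dominatingPairs_nonempty h).image _) ?_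
  rintro _ ⟨q, hq, rfl⟩
  exact hr q hq

theorem dualCost_nonneg (h : C(X × X, ℝ)) : 0 ≤ dualCost μ ν h :=
  le_dualCost fun _ hp => add_nonneg (integral_nonneg hp.1) (integral_nonneg hp.2.1)

theorem dualCost_eq_zero_of_nonpos {h : C(X × X, ℝ)} (hh : ∀ z, h z ≤ 0) :
    dualCost μ ν h = 0 := by
  refine le_antisymm ?_ (dualCost_nonneg h)
  simpa using dualCost_le (μ := μ) (ν := ν) (h := h) (p := (0, 0))
    ⟨fun _ => le_rfl, fun _ => le_rfl, fun x y => by simpa using hh (x, y)⟩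

theorem dualCost_smul {c : ℝ} (hc : 0 < c) (h : C(X × X, ℝ)) :
    dualCost μ ν (c • h) = c * dualCost μ ν h := by
  have key : ∀ {c : ℝ}, 0 < c → ∀ h : C(X × X, ℝ), c * dualCost μ ν h ≤ dualCost μ ν (c • h) := by
    intro c hc h
    refine le_dualCost fun p hp => ?_
    rw [← le_div_iff₀' hc]
    have hmem : c⁻¹ • p ∈ dominatingPairs h := by
      refine ⟨fun x => mul_nonneg (inv_pos.2 hc).le (hp.1 x),
        fun y => mul_nonneg (inv_pos.2 hc).le (hp.2.1 y), fun x y => ?_⟩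
      have := mul_le_mul_of_nonneg_left (hp.2.2 x y) (inv_pos.2 hc).le
      simp only [ContinuousMap.coe_smul, Pi.smul_apply, smul_eq_mul, inv_mul_cancel_left₀ hc.ne']
        at this
      simpa [mul_add] using this
    refine (dualCost_le hmem).trans_eq ?_
    simp only [Prod.smul_fst, Prod.smul_snd, ContinuousMap.coe_smul, Pi.smul_apply,
      smul_eq_mul, integral_const_mul]
    ring
  refine le_antisymm ?_ (key hc h)
  have := mul_le_mul_of_nonneg_left (key (inv_pos.2 hc) (c • h)) hc.le
  rwa [mul_inv_cancel_left₀ hc.ne', inv_smul_smul₀ hc.ne'] at this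

variable [BorelSpace X]

theorem dualCost_add_le [IsFiniteMeasure μ] [IsFiniteMeasure ν] (h k : C(X × X, ℝ)) :
    dualCost μ ν (h + k) ≤ dualCost μ ν h + dualCost μ ν k := by
  have int : ∀ (ρ : Measure X) [IsFiniteMeasure ρ] (f : C(X, ℝ)), Integrable f ρ :=
    fun ρ _ f => integrable_of_continuous_of_compactSpace f.continuous ρ
  rw [← sub_le_iff_le_add]
  refine le_dualCost fun p hp => ?_
  rw [sub_le_comm]
  refine le_dualCost fun q hq => ?_
  have hmem : p + q ∈ dominatingPairs (h + k) :=
    ⟨fun x => add_nonneg (hp.1 x) (hq.1 x), fun y => add_nonneg (hp.2.1 y) (hq.2.1 y), fun x y => by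
      have := add_le_add (hp.2.2 x y) (hq.2.2 x y)
      simpa [add_add_add_comm] using this⟩
  have := dualCost_le (μ := μ) (ν := ν) hmem
  simp only [Prod.fst_add, Prod.snd_add, ContinuousMap.coe_add, Pi.add_apply] at this
  rw [integral_add (int μ _) (int μ _), integral_add (int ν _) (int ν _)] at this
  linarith

/-- Strong duality, with attainment on the side of the plans.  Hahn–Banach gives a linear
functional below the sublinear functional `dualCost` which agrees with it at `k`; such a functional
is positive, so it is integration against a measure `γ`, and its values at `u(x)` and `v(y)` bound
the marginals of `γ`. -/
theorem exists_partialPlan_integral_eq_dualCost (μ ν : Measure X) [IsFiniteMeasure μ]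
    [IsFiniteMeasure ν] (k : C(X × X, ℝ)) :
    ∃ γ ∈ partialPlans μ ν, ∫ z, k z ∂γ = dualCost μ ν k := by
  have hzero : dualCost μ ν (0 : C(X × X, ℝ)) = 0 := dualCost_eq_zero_of_nonpos fun _ => le_rfl
  obtain ⟨L, hLk, hL⟩ := exists_extension_of_le_sublinear
    (LinearPMap.mkSpanSingleton' (σ := RingHom.id ℝ) k (dualCost μ ν k) (by
      intro c hc
      rcases smul_eq_zero.1 hc with rfl | rfl
      · simp
      · simp [hzero])) (dualCost μ ν)
    (fun c hc h => dualCost_smul hc h) dualCost_add_le (by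
      rintro ⟨_, hx⟩
      obtain ⟨c, rfl⟩ := Submodule.mem_span_singleton.1 hx
      rw [LinearPMap.mkSpanSingleton'_apply]
      simp only [RingHom.id_apply, smul_eq_mul]
      rcases lt_or_ge 0 c with hc | hc
      · exact (dualCost_smul hc k).ge
      · exact (mul_nonpos_of_nonpos_of_nonneg hc (dualCost_nonneg k)).trans (dualCost_nonneg _))
  have hLk : L k = dualCost μ ν k := by
    have := hLk ⟨k, Submodule.mem_span_singleton_self k⟩
    exact this.trans (LinearPMap.mkSpanSingleton'_apply_self _ _ _ _)
  have hpos : ∀ f : C(X × X, ℝ), (∀ z, 0 ≤ f z) → 0 ≤ L f := by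
    intro f hf
    have := hL (-f)
    rw [dualCost_eq_zero_of_nonpos (fun z => by simpa using hf z), map_neg] at this
    linarith
  obtain ⟨γ, hγ, hγL⟩ := exists_measure_integral_eq_of_nonneg L hpos
  refine ⟨γ, ⟨hγ, ?_, ?_⟩, (hγL k).trans hLk⟩
  · refine Measure.le_of_forall_integral_continuousMap_le fun u hu => ?_
    rw [Measure.fst, integral_map measurable_fst.aemeasurable
      u.continuous.aestronglyMeasurable]
    refine (hγL (u.comp .fst)).trans_le ((hL _).trans ?_)
    simpa using dualCost_le (μ := μ) (ν := ν) (h := u.comp .fst) (p := (u, 0))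
      ⟨hu, fun _ => le_rfl, fun x y => by simp⟩
  · refine Measure.le_of_forall_integral_continuousMap_le fun v hv => ?_
    rw [Measure.snd, integral_map measurable_snd.aemeasurable
      v.continuous.aestronglyMeasurable]
    refine (hγL (v.comp .snd)).trans_le ((hL _).trans ?_)
    simpa using dualCost_le (μ := μ) (ν := ν) (h := v.comp .snd) (p := (0, v))
      ⟨fun _ => le_rfl, hv, fun x y => by simp⟩

/-- Weak duality. -/
theorem integral_le_of_mem_dominatingPairs [IsFiniteMeasure μ] [IsFiniteMeasure ν]
    {k : C(X × X, ℝ)} {p : C(X, ℝ) × C(X, ℝ)} (hp : p ∈ dominatingPairs k)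
    {γ : Measure (X × X)} (hγ : γ ∈ partialPlans μ ν) :
    ∫ z, k z ∂γ ≤ ∫ x, p.1 x ∂μ + ∫ y, p.2 y ∂ν := by
  obtain ⟨hfin, h1, h2⟩ := hγ
  have int : ∀ f : C(X × X, ℝ), Integrable f γ :=
    fun f => integrable_of_continuous_of_compactSpace f.continuous γ
  calc ∫ z, k z ∂γ ≤ ∫ z, (p.1 z.1 + p.2 z.2) ∂γ :=
        integral_mono (int k) ((int (p.1.comp .fst)).add (int (p.2.comp .snd)))
          fun z => hp.2.2 z.1 z.2
    _ = ∫ z, p.1 z.1 ∂γ + ∫ z, p.2 z.2 ∂γ :=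
        integral_add (int (p.1.comp .fst)) (int (p.2.comp .snd))
    _ = ∫ x, p.1 x ∂γ.fst + ∫ y, p.2 y ∂γ.snd := by
        rw [Measure.fst, Measure.snd,
          integral_map measurable_fst.aemeasurable p.1.continuous.aestronglyMeasurable,
          integral_map measurable_snd.aemeasurable p.2.continuous.aestronglyMeasurable]
    _ ≤ _ := add_le_add
        (integral_mono_measure h1 (Filter.Eventually.of_forall hp.1)
          (integrable_of_continuous_of_compactSpace p.1.continuous μ))
        (integral_mono_measure h2 (Filter.Eventually.of_forall hp.2.1)
          (integrable_of_continuous_of_compactSpace p.2.continuous ν))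

end Duality
end EntropyPartialTransport

/-! ### Compactness of the geometric tree -/

namespace WeightedTree

variable {V : Type*} (T : WeightedTree V)

namespace PrePoint

variable {T}

/-- The point at distance `t` from `u` on the edge joining `u` and `v`. -/
noncomputable def onEdge {u v : V} (h : u = v ∨ T.graph.Adj u v)
    (t : Set.Icc (0 : ℝ) (T.nodeDist u v)) : T.PrePoint where
  fst := u
  snd := v
  eq_or_adj := h
  toFst := t
  toSnd := T.nodeDist u v - t
  toFst_nonneg := t.2.1
  toSnd_nonneg := sub_nonneg.2 t.2.2
  add_eq := add_sub_cancel _ _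

theorem isometry_onEdge {u v : V} (h : u = v ∨ T.graph.Adj u v) : Isometry (onEdge h) :=
  Isometry.of_dist_eq fun _ _ => treeDist_eq_of_same ⟨rfl, rfl⟩

theorem exists_onEdge_eq (p : T.PrePoint) : ∃ t, onEdge p.eq_or_adj t = p := by
  have hp := p.add_eq
  refine ⟨⟨p.toFst, p.toFst_nonneg, by linarith [p.toSnd_nonneg]⟩, ?_⟩
  have hs : T.nodeDist p.fst p.snd - p.toFst = p.toSnd := by linarith
  simp only [onEdge, hs]

/-- A finite tree is a finite union of isometric images of compact intervals. -/
instance [Finite V] : CompactSpace T.PrePoint := by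
  let K : V × V → Set T.PrePoint := fun e =>
    ⋃ h : e.1 = e.2 ∨ T.graph.Adj e.1 e.2, Set.range (onEdge h)
  have hK : ∀ e, IsCompact (K e) := fun e =>
    isCompact_iUnion fun h => isCompact_range (isometry_onEdge h).continuous
  refine ⟨(isCompact_iUnion hK).of_isClosed_subset isClosed_univ fun p _ => ?_⟩
  obtain ⟨t, ht⟩ := p.exists_onEdge_eq
  exact Set.mem_iUnion.2 ⟨(p.fst, p.snd), Set.mem_iUnion.2 ⟨p.eq_or_adj, t, ht⟩⟩

end PrePoint

instance [Finite V] : CompactSpace T.Space :=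
  ⟨(SeparationQuotient.surjective_mk (X := T.PrePoint)).range_eq ▸
    isCompact_range SeparationQuotient.continuous_mk⟩

end WeightedTree

/-! ### Reduction to Lipschitz potentials -/

namespace EntropyPartialTransport

variable {X : Type*} [MetricSpace X]

theorem continuous_of_abs_sub_le {b : ℝ} (hb : 0 ≤ b) {w : X → ℝ}
    (hw : ∀ x y, |w x - w y| ≤ b * dist x y) : Continuous w :=
  (LipschitzWith.of_dist_le_mul (K := ⟨b, hb⟩) hw).continuous

/-- What the objective saves per unit of mass transported from `x` to `y` instead of removed at
both ends. -/
def transportGain (w₁ w₂ : C(X, ℝ)) (b lam : ℝ) : C(X × X, ℝ) where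
  toFun z := w₁ z.1 + w₂ z.2 + b * lam - b * dist z.1 z.2

/-- On `Π_≤(μ, ν)` the objective is an affine function of the plan. -/
theorem objective_eq [CompactSpace X] [MeasurableSpace X] [BorelSpace X] {μ ν : Measure X}
    [IsFiniteMeasure μ] [IsFiniteMeasure ν] (w₁ w₂ : C(X, ℝ)) (b lam : ℝ)
    {γ : Measure (X × X)} (hγ : γ ∈ partialPlans μ ν) :
    objective (fun x y => dist x y) w₁ w₂ b lam μ ν γ =
      ∫ x, w₁ x ∂μ + ∫ y, w₂ y ∂ν - ∫ z, transportGain w₁ w₂ b lam z ∂γ := by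
  obtain ⟨hfin, h1, h2⟩ := hγ
  have int : ∀ {f : X × X → ℝ}, Continuous f → Integrable f γ :=
    fun hf => integrable_of_continuous_of_compactSpace hf γ
  have hc : Continuous fun z : X × X => dist z.1 z.2 - lam := by fun_prop
  have hw1 : Continuous fun z : X × X => w₁ z.1 := by fun_prop
  have hw2 : Continuous fun z : X × X => w₂ z.2 := by fun_prop
  have gain : ∫ z, transportGain w₁ w₂ b lam z ∂γ =
      ∫ z, w₁ z.1 ∂γ + ∫ z, w₂ z.2 ∂γ - b * ∫ z, (dist z.1 z.2 - lam) ∂γ := by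
    rw [← integral_const_mul, ← integral_add (int hw1) (int hw2),
      ← integral_sub (f := fun z => w₁ z.1 + w₂ z.2) (int (hw1.add hw2)) ((int hc).const_mul b)]
    refine integral_congr_ae (.of_forall fun z => ?_)
    simp only [transportGain, ContinuousMap.coe_mk]
    ring
  rw [objective,
    weightedEntropy_abs_sub_one h1 (integrable_of_continuous_of_compactSpace w₁.continuous μ),
    weightedEntropy_abs_sub_one h2 (integrable_of_continuous_of_compactSpace w₂.continuous ν),
    gain, Measure.fst, Measure.snd,
    integral_map measurable_fst.aemeasurable w₁.continuous.aestronglyMeasurable,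
    integral_map measurable_snd.aemeasurable w₂.continuous.aestronglyMeasurable]
  ring

/-- A potential `f` gives the dominating pair `(w₁ + bλ/2 - f, w₂ + bλ/2 + f)`. -/
theorem mem_dominatingPairs_of_mem_potentials {w₁ w₂ f : C(X, ℝ)} {b lam : ℝ}
    (hf : f ∈ potentials w₁ w₂ b lam) :
    (w₁ + .const X (b * lam / 2) - f, w₂ + .const X (b * lam / 2) + f) ∈
      dominatingPairs (transportGain w₁ w₂ b lam) := by
  refine ⟨fun x => ?_, fun y => ?_, fun x y => ?_⟩
  · simpa using (hf.1 x).2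
  · have := (hf.1 y).1
    simp only [ContinuousMap.add_apply, ContinuousMap.const_apply]
    linarith
  · have := (abs_le.1 (hf.2 x y)).2
    simp only [transportGain, ContinuousMap.coe_mk, ContinuousMap.add_apply,
      ContinuousMap.sub_apply, ContinuousMap.const_apply]
    linarith

/-- A dominating pair `(u, v)` is improved by a pair coming from a potential: the `b`-Lipschitz
function `f(x) = min (w₁(x) + bλ/2) (inf_y [b d(x, y) + v(y) - w₂(y) - bλ/2])` satisfies
`w₁ + bλ/2 - u ≤ f ≤ v - w₂ - bλ/2`. Its lower bound `-w₂ - bλ/2 ≤ f` holds for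
the first term by nonnegativity, for the infimum because `w₂` is `b`-Lipschitz and `v ≥ 0`. -/
theorem exists_mem_potentials_le [CompactSpace X] [Nonempty X] {w₁ w₂ : C(X, ℝ)} {b lam : ℝ}
    (hb : 0 ≤ b) (hlam : 0 ≤ lam)
    (hw₁ : ∀ x, 0 ≤ w₁ x) (hw₂ : ∀ x, 0 ≤ w₂ x) (hL₁ : ∀ x y, |w₁ x - w₁ y| ≤ b * dist x y)
    (hL₂ : ∀ x y, |w₂ x - w₂ y| ≤ b * dist x y) {p : C(X, ℝ) × C(X, ℝ)}
    (hp : p ∈ dominatingPairs (transportGain w₁ w₂ b lam)) :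
    ∃ f ∈ potentials w₁ w₂ b lam,
      (∀ x, w₁ x + b * lam / 2 - p.1 x ≤ f x) ∧ ∀ x, f x ≤ p.2 x - w₂ x - b * lam / 2 := by
  obtain ⟨hu, hv, huv⟩ := hp
  have hbl : 0 ≤ b * lam := mul_nonneg hb hlam
  let e : X → X → ℝ := fun x y => b * dist x y + p.2 y - w₂ y - b * lam / 2
  have hlow : ∀ x y, -w₂ x - b * lam / 2 ≤ e x y := fun x y => by
    have := (abs_le.1 (hL₂ y x)).2
    rw [dist_comm] at this
    have := hv y
    simp only [e]
    linarith
  have hbdd : ∀ x, BddBelow (Set.range (e x)) := fun x => ⟨_, by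
    rintro _ ⟨y, rfl⟩
    exact hlow x y⟩
  have hlip : ∀ x x', (⨅ y, e x y) ≤ b * dist x x' + ⨅ y, e x' y := fun x x' => by
    rw [← sub_le_iff_le_add']
    refine le_ciInf fun y => ?_
    have h1 := ciInf_le (hbdd x) y
    have h2 := mul_le_mul_of_nonneg_left (dist_triangle x x' y) hb
    simp only [e] at h1 ⊢
    linarith
  let g : X → ℝ := fun x => min (w₁ x + b * lam / 2) (⨅ y, e x y)
  have hg : ∀ x x', g x ≤ b * dist x x' + g x' := fun x x' => by
    simp only [g, ← min_add_add_left]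
    refine min_le_min ?_ (hlip x x')
    have := (abs_le.1 (hL₁ x x')).2
    linarith
  have hgL : ∀ x x', |g x - g x'| ≤ b * dist x x' := fun x x' => by
    have h1 := hg x x'
    have h2 := hg x' x
    rw [dist_comm x' x] at h2
    exact abs_le.2 ⟨by linarith, by linarith⟩
  refine ⟨⟨g, continuous_of_abs_sub_le hb hgL⟩, ⟨fun x => ⟨le_min ?_ (le_ciInf (hlow x)),
    min_le_left _ _⟩, hgL⟩, fun x => le_min ?_ (le_ciInf fun y => ?_), fun x => ?_⟩
  · linarith [hw₁ x, hw₂ x]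
  · linarith [hu x]
  · have := huv x y
    simp only [transportGain, ContinuousMap.coe_mk] at this
    simp only [e]
    linarith
  · refine (min_le_right _ _).trans ((ciInf_le (hbdd x) x).trans_eq ?_)
    simp only [e, dist_self]
    ring

/-- The duality formula on a compact metric space. -/
theorem ET_eq_iSup_potentials [CompactSpace X] [Nonempty X] [MeasurableSpace X] [BorelSpace X]
    {w₁ w₂ : C(X, ℝ)} {b lam : ℝ} (hb : 0 ≤ b) (hlam : 0 ≤ lam)
    (hw₁ : ∀ x, 0 ≤ w₁ x) (hw₂ : ∀ x, 0 ≤ w₂ x) (hL₁ : ∀ x y, |w₁ x - w₁ y| ≤ b * dist x y)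
    (hL₂ : ∀ x y, |w₂ x - w₂ y| ≤ b * dist x y) (μ ν : Measure X) [IsFiniteMeasure μ]
    [IsFiniteMeasure ν] :
    ET (fun x y => dist x y) w₁ w₂ b lam μ ν =
      (⨆ f ∈ potentials w₁ w₂ b lam, ((∫ x, f x ∂μ - ∫ x, f x ∂ν : ℝ) : EReal))
        - ((b * lam / 2 * (μ.real Set.univ + ν.real Set.univ) : ℝ) : EReal) := by
  have int : ∀ (ρ : Measure X) [IsFiniteMeasure ρ] (f : C(X, ℝ)), Integrable f ρ :=
    fun ρ _ f => integrable_of_continuous_of_compactSpace f.continuous ρ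
  have value : ∀ f : C(X, ℝ),
      ∫ x, (w₁ + .const X (b * lam / 2) - f) x ∂μ + ∫ y, (w₂ + .const X (b * lam / 2) + f) y ∂ν =
        ∫ x, w₁ x ∂μ + ∫ y, w₂ y ∂ν + b * lam / 2 * (μ.real Set.univ + ν.real Set.univ)
          - (∫ x, f x ∂μ - ∫ x, f x ∂ν) := by
    intro f
    simp only [ContinuousMap.coe_sub, ContinuousMap.coe_add]
    rw [integral_sub' ((int μ w₁).add (int μ _)) (int μ f), integral_add' (int μ w₁) (int μ _),
      integral_add' ((int ν w₂).add (int ν _)) (int ν f), integral_add' (int ν w₂) (int ν _)]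
    simp only [ContinuousMap.const_apply, integral_const, smul_eq_mul]
    ring
  refine le_antisymm ?_ (le_iInf₂ fun γ hγ => ?_)
  · obtain ⟨γ, hγ, hγk⟩ :=
      exists_partialPlan_integral_eq_dualCost μ ν (transportGain w₁ w₂ b lam)
    refine (iInf₂_le γ hγ).trans ?_
    rw [objective_eq w₁ w₂ b lam hγ, hγk,
      EReal.le_sub_iff_add_le (.inl (EReal.coe_ne_bot _)) (.inl (EReal.coe_ne_top _)),
      ← EReal.coe_add]
    -- the supremum is tested against real upper bounds `r`, as the dual infimum is real-valued
    refine EReal.le_of_forall_lt_iff_le.1 fun r hr => ?_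
    rw [EReal.coe_le_coe_iff, add_comm, ← add_sub_assoc, sub_le_comm]
    refine le_dualCost fun p hp => ?_
    obtain ⟨f, hf, hf1, hf2⟩ := exists_mem_potentials_le hb hlam hw₁ hw₂ hL₁ hL₂ hp
    have hfr : ∫ x, f x ∂μ - ∫ x, f x ∂ν ≤ r := EReal.coe_le_coe_iff.1
      ((le_iSup₂ (f := fun (f : C(X, ℝ)) (_ : f ∈ potentials w₁ w₂ b lam) =>
        ((∫ x, f x ∂μ - ∫ x, f x ∂ν : ℝ) : EReal)) f hf).trans hr.le)
    have h1 : ∫ x, (w₁ + .const X (b * lam / 2) - f) x ∂μ ≤ ∫ x, p.1 x ∂μ :=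
      integral_mono (int μ _) (int μ _) fun x => by
        have := hf1 x
        simp only [ContinuousMap.sub_apply, ContinuousMap.add_apply, ContinuousMap.const_apply]
        linarith
    have h2 : ∫ x, (w₂ + .const X (b * lam / 2) + f) x ∂ν ≤ ∫ x, p.2 x ∂ν :=
      integral_mono (int ν _) (int ν _) fun x => by
        have := hf2 x
        simp only [ContinuousMap.add_apply, ContinuousMap.const_apply]
        linarith
    linarith [value f]
  · rw [EReal.sub_le_iff_le_add (.inl (EReal.coe_ne_bot _)) (.inl (EReal.coe_ne_top _)),
      ← EReal.coe_add, objective_eq w₁ w₂ b lam hγ]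
    refine iSup₂_le fun f hf => EReal.coe_le_coe_iff.2 ?_
    have := integral_le_of_mem_dominatingPairs (mem_dominatingPairs_of_mem_potentials hf) hγ
    rw [value f] at this
    linarith

end EntropyPartialTransport

theorem corollary3p5 {V : Type*} [Finite V] (T : WeightedTree V)
    (b lam : ℝ) (hb : 0 ≤ b) (hlam : 0 ≤ lam)
    (w₁ w₂ : T.Space → ℝ) (hw₁ : ∀ x, 0 ≤ w₁ x) (hw₂ : ∀ x, 0 ≤ w₂ x)
    (hL₁ : ∀ x y, |w₁ x - w₁ y| ≤ b * dist x y) (hL₂ : ∀ x y, |w₂ x - w₂ y| ≤ b * dist x y)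
    (μ ν : Measure T.Space) [IsFiniteMeasure μ] [IsFiniteMeasure ν] :
    EntropyPartialTransport.ET (fun x y => dist x y) w₁ w₂ b lam μ ν =
      (⨆ f ∈ EntropyPartialTransport.potentials w₁ w₂ b lam,
          ((∫ x, f x ∂μ - ∫ x, f x ∂ν : ℝ) : EReal))
        - ((b * lam / 2 * (μ.real Set.univ + ν.real Set.univ) : ℝ) : EReal) := by
  have hne : Nonempty T.Space := by
    obtain ⟨v⟩ := T.isTree.connected.nonempty
    have h0 := T.nodeDist_nonneg v v
    exact ⟨SeparationQuotient.mk (WeightedTree.PrePoint.onEdge (.inl rfl) ⟨0, le_rfl, h0⟩)⟩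
  exact EntropyPartialTransport.ET_eq_iSup_potentials
    (w₁ := ⟨w₁, EntropyPartialTransport.continuous_of_abs_sub_le hb hL₁⟩)
    (w₂ := ⟨w₂, EntropyPartialTransport.continuous_of_abs_sub_le hb hL₂⟩)
    hb hlam hw₁ hw₂ hL₁ hL₂ μ ν
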